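/- For an integer $\ell \ge 3$ let $C_\ell$ denote the cycle with $\ell$ vertices, and let $G \,\square\, H$ denote the Cartesian product of the graphs $G$ and $H$. A graph $H$ is said to decompose a graph $G$ if there is a set of subgraphs of $G$, each isomorphic to $H$, whose edge sets partition the edge set of $G$. Theorem. If $k$, $m$ and $n$ are positive integers and $k$ divides $4mn$, then $C_{4k}$ decomposes $C_{4m} \,\square\, C_{4n}$. -/

import Mathlib

/-- `H` decomposes `G`: there is a set of subgraphs of `G`, each isomorphic to `H`, whose edge sets
are pairwise disjoint and have union the edge set of `G`. -/
def SimpleGraph.Decomposes {W V : Type*} (H : SimpleGraph W) (G : SimpleGraph V) : Prop :=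
  ∃ D : Set G.Subgraph,
    (∀ S ∈ D, Nonempty (S.coe ≃g H)) ∧
    D.PairwiseDisjoint SimpleGraph.Subgraph.edgeSet ∧
    (⋃ S ∈ D, S.edgeSet) = G.edgeSet

/-!
The torus `C_{4m} □ C_{4n}` is a checkerboard of unit squares. The squares with lower left corner
in an even column and an even row form a 2-factor, those with both coordinates odd form the
complementary 2-factor, and the other squares are the *faces* between them. A face lies between two
neighbouring squares of the one 2-factor, and, in the perpendicular direction, between two of
the other one. Exchanging the two pairs of opposite edges of a face between the 2-factors
merges these squares in both 2-factors at once. If the exchanged faces, regarded as edges between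
the squares of either 2-factor, form a forest all of whose trees have `k` nodes, then each tree is
merged into one cycle of length `4 * k`, and these cycles decompose the torus.

The cycles are handled as orbits of permutations. One traverses a 2-factor by turning around the
squares (`torusRot`), changing to another square at each exchanged face (`torusCross`).
Such a tour returns to a square from each of its subtrees, so it goes around the whole tree
(`sameCycle_cross`, `card_orbit_tour`). The tours of the two 2-factors use complementary pairs of
edges at every vertex (`tour_step_or_dualTour_step`, `tour_step_disjoint`), which is what
`SimpleGraph.cycleGraph_decomposes_of_perm` needs.

It remains to choose the faces on the `2m × 2n` torus of squares. Each square is given at most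
one link, to the right or up; in the other 2-factor this link goes down or left (`upParent`,
`downParent`). By `k ∣ (2 * m) * (2 * n)` there are `a ∣ 2 * m` and `b ∣ 2 * n` with `k = a * b`.
If neither or both are `1`, a pattern with period `a × b` works (`blockLink`). If `a = 1` and `k` is
even, `a = 2` and `b = k / 2` can be used instead, except for `k = 2` (`pairLink`). If `a = 1` and
`k ≥ 3` is odd, a block of two columns and `k` rows is divided into two trees (`oddLink`). The case
`b = 1` follows by exchanging the two factors.
-/

/-! ### Decompositions from permutations -/

/-- The copies of `H` are transported along the isomorphism. -/
theorem SimpleGraph.Decomposes.of_iso {W V V' : Type*} {H : SimpleGraph W} {G : SimpleGraph V}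
    {G' : SimpleGraph V'} (h : H.Decomposes G) (e : G ≃g G') : H.Decomposes G' := by
  obtain ⟨D, hiso, hdisj, hunion⟩ := h
  have hinj : Function.Injective (Sym2.map e) := Sym2.map.injective e.injective
  refine ⟨(fun S => S.map e.toHom) '' D, ?_, ?_, ?_⟩
  · rintro _ ⟨S, hS, rfl⟩
    obtain ⟨φ⟩ := hiso S hS
    refine ⟨RelIso.trans (RelIso.symm ⟨Equiv.Set.image e S.verts e.injective, ?_⟩) φ⟩
    rintro ⟨a, ha⟩ ⟨b, hb⟩
    simp only [SimpleGraph.Subgraph.coe_adj]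
    exact Relation.map_apply_apply e.injective e.injective _ _ _
  · rintro _ ⟨S, hS, rfl⟩ _ ⟨S', hS', rfl⟩ hne
    have hSS' : S ≠ S' := fun h => hne (by rw [h])
    simp only [Function.onFun, SimpleGraph.Subgraph.edgeSet_map]
    exact (Set.disjoint_image_iff hinj).2 (hdisj hS hS' hSS')
  · rw [Set.biUnion_image]
    simp only [SimpleGraph.Subgraph.edgeSet_map]
    rw [← Set.image_iUnion₂, hunion]
    ext x
    induction x with | _ a b
    constructor
    · rintro ⟨y, hy, hxy⟩
      induction y with | _ c d
      rw [← hxy]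
      exact e.map_adj_iff.2 hy
    · intro hab
      refine ⟨s(e.symm a, e.symm b), e.symm.map_adj_iff.2 hab, ?_⟩
      exact Sym2.map_mk .. |>.trans (by simp)

/-- An orbit of `σ` of size `n` is listed by `Fin n` so that `σ` acts as the cyclic successor. -/
theorem Equiv.Perm.exists_cycle_parametrization {V : Type*} [Finite V] (σ : Equiv.Perm V) (v : V)
    {n : ℕ} (hcard : Nat.card {w // σ.SameCycle v w} = n + 2) :
    ∃ f : Fin (n + 2) → V, Function.Injective f ∧ (∀ i, σ (f i) = f (i + 1)) ∧
      ∀ w, σ.SameCycle v w ↔ w ∈ Set.range f := by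
  have hsame : ∀ w, σ.SameCycle v w ↔ ∃ i, σ^[i] v = w := by
    intro w
    constructor
    · intro h
      obtain ⟨i, hi⟩ := h.exists_nat_pow_eq
      exact ⟨i, by rw [← Equiv.Perm.coe_pow, hi]⟩
    · rintro ⟨i, rfl⟩
      exact ⟨i, by rw [zpow_natCast, Equiv.Perm.coe_pow]⟩
  have hper : v ∈ Function.periodicPts σ :=
    σ.injective.mem_periodicPts v
  have hpos := Function.minimalPeriod_pos_of_mem_periodicPts hper
  have hinj : Function.Injective
      (fun i : Fin (Function.minimalPeriod σ v) => σ^[i] v) := by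
    intro i j hij
    exact Fin.ext (Function.iterate_injOn_Iio_minimalPeriod i.2 j.2 hij)
  have hp : Function.minimalPeriod σ v = n + 2 := by
    rw [← hcard, ← Nat.card_fin (Function.minimalPeriod σ v)]
    refine Nat.card_congr (Equiv.ofBijective
      (fun i => ⟨σ^[i] v, (hsame _).2 ⟨i, rfl⟩⟩) ⟨?_, ?_⟩)
    · intro i j hij
      exact hinj (congrArg Subtype.val hij)
    · rintro ⟨w, hw⟩
      obtain ⟨i, rfl⟩ := (hsame w).1 hw
      refine ⟨⟨i % Function.minimalPeriod σ v, Nat.mod_lt _ hpos⟩, Subtype.ext ?_⟩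
      exact Function.iterate_mod_minimalPeriod_eq
  refine ⟨fun i => σ^[i] v, ?_, ?_, ?_⟩
  · intro i j hij
    exact Fin.ext (Function.iterate_injOn_Iio_minimalPeriod (i.2.trans_eq hp.symm)
      (j.2.trans_eq hp.symm) hij)
  · intro i
    have : ((i + 1 : Fin (n + 2)) : ℕ) = (i.val + 1) % Function.minimalPeriod σ v := by
      rw [hp, Fin.val_add, Fin.val_one]
    simp only [this, Function.iterate_mod_minimalPeriod_eq]
    exact (Function.iterate_succ_apply' _ _ _).symm
  · intro w
    rw [hsame]
    constructor
    · rintro ⟨i, rfl⟩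
      refine ⟨⟨i % (n + 2), Nat.mod_lt _ (by omega)⟩, ?_⟩
      simp only [← hp]
      exact Function.iterate_mod_minimalPeriod_eq
    · rintro ⟨i, rfl⟩
      exact ⟨i, rfl⟩

/-- `x` and `y` are joined by a step of the permutation `σ`, in either direction. -/
def Equiv.Perm.Step {V : Type*} (σ : Equiv.Perm V) (x y : V) : Prop := y = σ x ∨ x = σ y

theorem Equiv.Perm.step_iff {V : Type*} {σ : Equiv.Perm V} {x y : V} :
    σ.Step x y ↔ y = σ x ∨ y = σ.symm x := by
  rw [Equiv.Perm.Step, Equiv.eq_symm_apply, @eq_comm _ x]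

theorem Equiv.Perm.Step.symm {V : Type*} {σ : Equiv.Perm V} {x y : V} (h : σ.Step x y) :
    σ.Step y x := Or.symm h

theorem Equiv.Perm.Step.sameCycle {V : Type*} {σ : Equiv.Perm V} {x y : V} (h : σ.Step x y) :
    σ.SameCycle x y := by
  rcases h with rfl | rfl
  · exact Equiv.Perm.sameCycle_apply_right.2 (Equiv.Perm.SameCycle.refl _ _)
  · exact Equiv.Perm.sameCycle_apply_left.2 (Equiv.Perm.SameCycle.refl _ _)

theorem Equiv.Perm.step_iff_cycleGraph_adj {V : Type*} {σ : Equiv.Perm V} {n : ℕ}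
    {f : Fin (n + 2) → V} (hf : Function.Injective f) (hσ : ∀ i, σ (f i) = f (i + 1))
    (i j : Fin (n + 2)) :
    σ.Step (f i) (f j) ↔ (SimpleGraph.cycleGraph (n + 2)).Adj i j := by
  rw [SimpleGraph.cycleGraph_adj, Equiv.Perm.Step, hσ, hσ, hf.eq_iff, hf.eq_iff, sub_eq_iff_eq_add,
    sub_eq_iff_eq_add, or_comm, add_comm 1, add_comm 1]

/-- A graph whose edges are the steps of a cyclic permutation is a cycle graph. -/
theorem Equiv.Perm.nonempty_iso_cycleGraph {V : Type*} [Finite V] {G : SimpleGraph V}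
    {σ : Equiv.Perm V} {n : ℕ} (hcard : Nat.card V = n + 2) (v : V)
    (hcyc : ∀ w, σ.SameCycle v w) (hadj : ∀ x y, G.Adj x y ↔ σ.Step x y) :
    Nonempty (G ≃g SimpleGraph.cycleGraph (n + 2)) := by
  obtain ⟨f, hinj, hstep, hrange⟩ := σ.exists_cycle_parametrization v (n := n)
    (by rw [← hcard]; exact Nat.card_congr (Equiv.subtypeUnivEquiv hcyc))
  refine ⟨RelIso.symm ⟨Equiv.ofBijective f ⟨hinj, fun w => (hrange w).1 (hcyc w)⟩, ?_⟩⟩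
  intro i j
  rw [← Equiv.Perm.step_iff_cycleGraph_adj hinj hstep, ← hadj]
  rfl

/-- The subgraph formed by the steps of `σ` inside the orbit of `v`. -/
def SimpleGraph.orbitSubgraph {V : Type*} (G : SimpleGraph V) (σ : Equiv.Perm V)
    (hσ : ∀ x y, σ.Step x y → G.Adj x y) (v : V) : G.Subgraph where
  verts := {w | σ.SameCycle v w}
  Adj x y := σ.SameCycle v x ∧ σ.Step x y
  adj_sub h := hσ _ _ h.2
  edge_vert h := h.1
  symm := ⟨fun _ _ h => ⟨h.1.trans h.2.sameCycle, h.2.symm⟩⟩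

theorem SimpleGraph.orbitSubgraph_nonempty_iso {V : Type*} [Finite V] (G : SimpleGraph V)
    (σ : Equiv.Perm V) (hσ : ∀ x y, σ.Step x y → G.Adj x y) (v : V) {n : ℕ}
    (hcard : Nat.card {w // σ.SameCycle v w} = n + 2) :
    Nonempty ((G.orbitSubgraph σ hσ v).coe ≃g SimpleGraph.cycleGraph (n + 2)) := by
  obtain ⟨f, hinj, hstep, hrange⟩ := σ.exists_cycle_parametrization v hcard
  refine ⟨RelIso.symm ⟨Equiv.ofBijective
    (fun i => ⟨f i, (hrange _).2 ⟨i, rfl⟩⟩ : Fin (n + 2) → (G.orbitSubgraph σ hσ v).verts)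
    ⟨?_, ?_⟩, ?_⟩⟩
  · intro i j hij
    exact hinj (congrArg Subtype.val hij)
  · rintro ⟨w, hw⟩
    obtain ⟨i, hi⟩ := (hrange w).1 hw
    exact ⟨i, Subtype.ext hi⟩
  · intro i j
    rw [← Equiv.Perm.step_iff_cycleGraph_adj hinj hstep]
    exact ⟨fun h => h.2, fun h => ⟨(hrange _).2 ⟨i, rfl⟩, h⟩⟩

theorem SimpleGraph.orbitSubgraph_eq_of_sameCycle {V : Type*} {G : SimpleGraph V}
    {σ : Equiv.Perm V} {hσ : ∀ x y, σ.Step x y → G.Adj x y} {v w : V} (h : σ.SameCycle v w) :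
    G.orbitSubgraph σ hσ v = G.orbitSubgraph σ hσ w := by
  have key : ∀ x, σ.SameCycle v x ↔ σ.SameCycle w x :=
    fun x => ⟨h.symm.trans, h.trans⟩
  ext x y
  · exact key x
  · exact and_congr_left fun _ => key x

/-- If the edges of `G` are the steps of two permutations, no edge being a step of both, and all
orbits of both have size `n + 2`, then the orbits are the cycles of a decomposition. -/
theorem SimpleGraph.cycleGraph_decomposes_of_perm {V : Type*} [Finite V] {G : SimpleGraph V}
    {σ τ : Equiv.Perm V} {n : ℕ} (hadj : ∀ x y, G.Adj x y ↔ σ.Step x y ∨ τ.Step x y)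
    (hdisj : ∀ x y, σ.Step x y → ¬ τ.Step x y)
    (hσ : ∀ v, Nat.card {w // σ.SameCycle v w} = n + 2)
    (hτ : ∀ v, Nat.card {w // τ.SameCycle v w} = n + 2) :
    (SimpleGraph.cycleGraph (n + 2)).Decomposes G := by
  have hσG : ∀ x y, σ.Step x y → G.Adj x y := fun x y h => (hadj x y).2 (Or.inl h)
  have hτG : ∀ x y, τ.Step x y → G.Adj x y := fun x y h => (hadj x y).2 (Or.inr h)
  refine ⟨Set.range (G.orbitSubgraph σ hσG) ∪ Set.range (G.orbitSubgraph τ hτG), ?_, ?_, ?_⟩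
  · rintro _ (⟨v, rfl⟩ | ⟨v, rfl⟩)
    · exact G.orbitSubgraph_nonempty_iso σ hσG v (hσ v)
    · exact G.orbitSubgraph_nonempty_iso τ hτG v (hτ v)
  · rintro S hS S' hS' hne
    refine Set.disjoint_left.2 fun e => ?_
    induction e with | _ x y
    intro h h'
    rcases hS with ⟨v, rfl⟩ | ⟨v, rfl⟩ <;> rcases hS' with ⟨w, rfl⟩ | ⟨w, rfl⟩
    · exact hne (orbitSubgraph_eq_of_sameCycle (h.1.trans h'.1.symm))
    · exact hdisj x y h.2 h'.2
    · exact hdisj x y h'.2 h.2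
    · exact hne (orbitSubgraph_eq_of_sameCycle (h.1.trans h'.1.symm))
  · ext e
    induction e with | _ x y
    simp only [Set.mem_iUnion, SimpleGraph.mem_edgeSet, exists_prop]
    constructor
    · rintro ⟨S, -, h⟩
      exact S.adj_sub h
    · intro h
      rcases (hadj x y).1 h with h | h
      · exact ⟨_, Or.inl ⟨x, rfl⟩, Equiv.Perm.SameCycle.refl _ _, h⟩
      · exact ⟨_, Or.inr ⟨x, rfl⟩, Equiv.Perm.SameCycle.refl _ _, h⟩

/-! ### Tours around a forest -/

/-- `p` is the parent map of a rooted forest on `T`, each of whose trees has `k` nodes: `root`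
labels the trees, and the rank `rank` increases towards the roots. -/
def IsForestOfSize {T : Type*} (p : T → Option T) (k : ℕ) : Prop :=
  ∃ (R : Type) (root : T → R) (rank : T → ℕ),
    (∀ t t', p t = some t' → root t' = root t ∧ rank t < rank t') ∧
    (∀ t t', p t = none → p t' = none → root t = root t' → t = t') ∧
    ∀ t, Nat.card {t' // root t' = root t} = k

/-- Trees of size `k` are recognised by numbering the nodes of each tree by a type of size `k`. -/
theorem IsForestOfSize.of_injective {T : Type*} [Finite T] {p : T → Option T} {R K : Type}
    [Finite R] [Finite K] (root : T → R) (loc : T → K) (rank : T → ℕ)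
    (hp : ∀ t t', p t = some t' → root t' = root t ∧ rank t < rank t')
    (huniq : ∀ t t', p t = none → p t' = none → root t = root t' → t = t')
    (hinj : ∀ t t', root t = root t' → loc t = loc t' → t = t')
    (hcard : Nat.card T = Nat.card R * Nat.card K) : IsForestOfSize p (Nat.card K) := by
  refine ⟨R, root, rank, hp, huniq, fun t => ?_⟩
  have hbij : Function.Bijective (fun t => (root t, loc t)) := by
    refine (Nat.bijective_iff_injective_and_card _).2 ⟨?_, by rw [hcard, Nat.card_prod]⟩
    intro t t' h
    exact hinj t t' (congrArg Prod.fst h) (congrArg Prod.snd h)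
  refine Nat.card_congr (Equiv.ofBijective (fun t' => loc t'.1) ⟨?_, ?_⟩)
  · rintro ⟨s, hs⟩ ⟨s', hs'⟩ h
    exact Subtype.ext (hinj s s' (hs.trans hs'.symm) h)
  · intro y
    obtain ⟨s, hs⟩ := hbij.2 (root t, y)
    exact ⟨⟨s, congrArg Prod.fst hs⟩, congrArg Prod.snd hs⟩

section Tour

variable {V T : Type*} {rot cross : Equiv.Perm V} {cell : V → T} {p : T → Option T}
  {out : T → Option V} {k : ℕ}

/-- A tour turns around inside a cell by `rot`, unless the involution `cross` takes it to another
cell. If all crossings are between a node `t` of a forest, left at `out t`, and its parent, then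
each crossing is undone in the course of the tour, so the tour of a cell together with the
tours of its descendants is a single orbit. -/
theorem sameCycle_cross (hcross : ∀ w, cross (cross w) = w)
    (hrot : ∀ w w', cell w = cell w' → ∃ n : ℕ, (rot ^ n) w = w')
    (hcell : ∀ w, cell (rot w) = cell w)
    (hout : ∀ t w, out t = some w → cell w = t ∧ p t = some (cell (cross w)))
    (hmove : ∀ w, cross w ≠ w → out (cell w) = some w ∨ out (cell (cross w)) = some (cross w))
    (rank : T → ℕ) (hrank : ∀ t t', p t = some t' → rank t < rank t') :
    (∀ t u, out t = some u → (rot * cross).SameCycle u (cross u)) ∧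
      ∀ w w', cell w = cell w' → (rot * cross).SameCycle w w' := by
  set σ := rot * cross with hσ
  have apply_right : ∀ w, σ.SameCycle w (rot (cross w)) :=
    fun w => Equiv.Perm.sameCycle_apply_right.2 (Equiv.Perm.SameCycle.refl _ _)
  have apply_cross : ∀ w, σ.SameCycle (cross w) (rot w) := by
    intro w
    simpa only [hcross] using apply_right (cross w)
  -- Away from the exit of its cell, a rotation step is realised by touring a child, if any.
  have step : ∀ w, (∀ s u, out s = some u → rank s < rank (cell w) → σ.SameCycle u (cross u)) →
      out (cell w) ≠ some w → σ.SameCycle w (rot w) := by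
    intro w ih hw
    by_cases hfix : cross w = w
    · simpa only [hfix] using apply_right w
    · have hchild := (hmove w hfix).resolve_left hw
      have hlt := hrank _ _ (hout _ _ hchild).2
      rw [hcross] at hlt
      have := ih _ _ hchild hlt
      rw [hcross] at this
      exact this.symm.trans (apply_cross w)
  have rot_pow_cell : ∀ (n : ℕ) w, cell ((rot ^ n) w) = cell w := by
    intro n w
    induction n with
    | zero => rfl
    | succ n ih => rw [pow_succ', Equiv.Perm.mul_apply, hcell, ih]
  have around : ∀ u, (∀ s u', out s = some u' → rank s < rank (cell u) →
      σ.SameCycle u' (cross u')) → out (cell u) = some u → σ.SameCycle u (cross u) := by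
    intro u ih hu
    have key : ∀ n : ℕ, σ.SameCycle (rot u) ((rot ^ n) (rot u)) := by
      intro n
      induction n with
      | zero => exact Equiv.Perm.SameCycle.refl _ _
      | succ n ihn =>
        rw [pow_succ', Equiv.Perm.mul_apply]
        by_cases heq : (rot ^ n) (rot u) = u
        · rw [heq]
        · refine ihn.trans (step _ ?_ ?_)
          · rw [rot_pow_cell, hcell]
            exact ih
          · rw [rot_pow_cell, hcell, hu]
            exact fun h => heq (Option.some.inj h).symm
    obtain ⟨n, hn⟩ := hrot (rot u) u (hcell u)
    have := key n
    rw [hn] at this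
    exact ((apply_cross u).trans this).symm
  have hup : ∀ N t u, rank t < N → out t = some u → σ.SameCycle u (cross u) := by
    intro N
    induction N with
    | zero => intro t u h; omega
    | succ N ih =>
      intro t u ht hu
      obtain ⟨rfl, -⟩ := hout t u hu
      exact around u (fun s u' hs hlt => ih s u' (by omega) hs) hu
  have hup' : ∀ t u, out t = some u → σ.SameCycle u (cross u) :=
    fun t u => hup _ t u (Nat.lt_succ_self _)
  have hstep : ∀ w, σ.SameCycle w (rot w) := by
    intro w
    by_cases hw : out (cell w) = some w
    · exact (hup' _ _ hw).trans (apply_cross w)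
    · exact step w (fun s u hs _ => hup' s u hs) hw
  refine ⟨hup', fun w w' hww' => ?_⟩
  obtain ⟨n, rfl⟩ := hrot w w' hww'
  clear hww'
  induction n with
  | zero => exact Equiv.Perm.SameCycle.refl _ _
  | succ n ih =>
    rw [pow_succ', Equiv.Perm.mul_apply]
    exact ih.trans (hstep _)

/-- The orbits of a tour around a forest are the sets of vertices in the cells of a tree. -/
theorem card_orbit_tour [Finite V] [Finite T] (hp : IsForestOfSize p k)
    (hcross : ∀ w, cross (cross w) = w)
    (hrot : ∀ w w', cell w = cell w' → ∃ n : ℕ, (rot ^ n) w = w')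
    (hcell : ∀ w, cell (rot w) = cell w)
    (hout : ∀ t w, out t = some w → cell w = t ∧ p t = some (cell (cross w)))
    (hnone : ∀ t, out t = none → p t = none)
    (hmove : ∀ w, cross w ≠ w → out (cell w) = some w ∨ out (cell (cross w)) = some (cross w))
    {c : ℕ} (hc : ∀ t, Nat.card {w // cell w = t} = c) (v : V) :
    Nat.card {w // (rot * cross).SameCycle v w} = c * k := by
  obtain ⟨R, root, rank, hpar, huniq, hcard⟩ := hp
  obtain ⟨hup, hsame⟩ := sameCycle_cross hcross hrot hcell hout hmove rank
    (fun t t' h => (hpar t t' h).2)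
  have root_step : ∀ w, root (cell ((rot * cross) w)) = root (cell w) := by
    intro w
    rw [Equiv.Perm.mul_apply, hcell]
    by_cases hfix : cross w = w
    · rw [hfix]
    · rcases hmove w hfix with h | h
      · exact (hpar _ _ (hout _ _ h).2).1
      · have := (hpar _ _ (hout _ _ h).2).1
        rw [hcross] at this
        exact this.symm
  have root_eq : ∀ w w', (rot * cross).SameCycle w w' → root (cell w) = root (cell w') := by
    intro w w' h
    obtain ⟨n, rfl⟩ := h.exists_nat_pow_eq
    clear h
    induction n with
    | zero => rfl
    | succ n ih => rw [pow_succ', Equiv.Perm.mul_apply, root_step, ih]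
  obtain ⟨B, hB⟩ : ∃ B, ∀ t, rank t ≤ B := by
    obtain ⟨B, hB⟩ := (Set.finite_range rank).bddAbove
    exact ⟨B, fun t => hB ⟨t, rfl⟩⟩
  have toRoot : ∀ N w, B - rank (cell w) < N →
      ∃ w', p (cell w') = none ∧ (rot * cross).SameCycle w w' := by
    intro N
    induction N with
    | zero => intro w h; omega
    | succ N ih =>
      intro w hw
      rcases hu : out (cell w) with _ | u
      · exact ⟨w, hnone _ hu, Equiv.Perm.SameCycle.refl _ _⟩
      · obtain ⟨hcu, hpu⟩ := hout _ _ hu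
        have hlt := (hpar _ _ hpu).2
        have hle := hB (cell (cross u))
        obtain ⟨w', hw', hs⟩ := ih (cross u) (by omega)
        exact ⟨w', hw', ((hsame w u hcu.symm).trans (hup _ _ hu)).trans hs⟩
  have key : ∀ w w', (rot * cross).SameCycle w w' ↔ root (cell w') = root (cell w) := by
    refine fun w w' => ⟨fun h => (root_eq w w' h).symm, fun h => ?_⟩
    obtain ⟨x, hx, hwx⟩ := toRoot _ w (Nat.lt_succ_self _)
    obtain ⟨x', hx', hwx'⟩ := toRoot _ w' (Nat.lt_succ_self _)
    refine hwx.trans ((hsame x x' (huniq _ _ hx hx' ?_)).trans hwx'.symm)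
    rw [← root_eq _ _ hwx, ← root_eq _ _ hwx', h]
  have e1 : {w // (rot * cross).SameCycle v w} ≃
      (s : {t // root t = root (cell v)}) × {w // cell w = s.1} :=
    { toFun := fun w => ⟨⟨cell w.1, (key _ _).1 w.2⟩, ⟨w.1, rfl⟩⟩
      invFun := fun x => ⟨x.2.1, (key _ _).2 (by rw [x.2.2]; exact x.1.2)⟩
      left_inv := fun _ => rfl
      right_inv := by
        rintro ⟨⟨t, ht⟩, ⟨w, hw⟩⟩
        dsimp only at hw
        subst hw
        rfl }
  have := Fintype.ofFinite {t // root t = root (cell v)}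
  rw [Nat.card_congr e1, Nat.card_sigma]
  simp only [hc, Finset.sum_const, smul_eq_mul, Finset.card_univ, ← Nat.card_eq_fintype_card,
    hcard]
  exact mul_comm _ _

end Tour

/-! ### The torus as a pattern of squares -/

section Torus

variable {I J : Type*}

/-- The permutation of `I × Bool` that subdivides each step of `s` into two steps. -/
def double (s : Equiv.Perm I) : Equiv.Perm (I × Bool) where
  toFun
    | (i, false) => (i, true)
    | (i, true) => (s i, false)
  invFun
    | (i, false) => (s.symm i, true)
    | (i, true) => (i, false)
  left_inv := by rintro ⟨i, _ | _⟩ <;> simp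
  right_inv := by rintro ⟨i, _ | _⟩ <;> simp

@[simp] theorem double_false (s : Equiv.Perm I) (i : I) : double s (i, false) = (i, true) := rfl
@[simp] theorem double_true (s : Equiv.Perm I) (i : I) : double s (i, true) = (s i, false) := rfl
@[simp] theorem double_symm_false (s : Equiv.Perm I) (i : I) :
    (double s).symm (i, false) = (s.symm i, true) := rfl
@[simp] theorem double_symm_true (s : Equiv.Perm I) (i : I) :
    (double s).symm (i, true) = (i, false) := rfl

theorem double_sameCycle {s : Equiv.Perm I} (hs : ∀ i i', s.SameCycle i i') (x y : I × Bool) :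
    (double s).SameCycle x y := by
  have hsq : ∀ i, ((double s) ^ 2) (i, false) = (s i, false) := fun i => rfl
  have hpow : ∀ (n : ℕ) i, (((double s) ^ 2) ^ n) (i, false) = ((s ^ n) i, false) := by
    intro n i
    induction n with
    | zero => rfl
    | succ n ih => rw [pow_succ', Equiv.Perm.mul_apply, ih, hsq, pow_succ', Equiv.Perm.mul_apply]
  have h0 : ∀ i i', (double s).SameCycle (i, false) (i', false) := by
    intro i i'
    obtain ⟨n, hn⟩ := hs i i'
    obtain ⟨n, rfl | rfl⟩ := n.eq_nat_or_neg
    · refine Equiv.Perm.SameCycle.of_pow (n := 2) ⟨n, ?_⟩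
      rw [zpow_natCast] at hn ⊢
      rw [hpow, hn]
    · refine (Equiv.Perm.SameCycle.of_pow (n := 2) ⟨n, ?_⟩).symm
      rw [zpow_neg, Equiv.Perm.inv_eq_iff_eq, zpow_natCast] at hn
      rw [zpow_natCast, hpow, hn]
  have hx : ∀ x, ∃ i, (double s).SameCycle x (i, false) := by
    rintro ⟨i, _ | _⟩
    · exact ⟨i, Equiv.Perm.SameCycle.refl _ _⟩
    · exact ⟨i, Equiv.Perm.sameCycle_apply_left.1 (h0 (s i) i)⟩
  obtain ⟨i, hi⟩ := hx x
  obtain ⟨j, hj⟩ := hx y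
  exact (hi.trans (h0 i j)).trans hj.symm

/-- The cell of a vertex of the torus; a cell consists of the four corners of a square. -/
def torusCell (v : (I × Bool) × (J × Bool)) : I × J := (v.1.1, v.2.1)

/-- The counterclockwise rotation of all cells. -/
def torusRot : Equiv.Perm ((I × Bool) × (J × Bool)) where
  toFun v := ((v.1.1, !v.2.2), (v.2.1, v.1.2))
  invFun v := ((v.1.1, v.2.2), (v.2.1, !v.1.2))
  left_inv := by rintro ⟨⟨i, _ | _⟩, ⟨j, _ | _⟩⟩ <;> rfl
  right_inv := by rintro ⟨⟨i, _ | _⟩, ⟨j, _ | _⟩⟩ <;> rfl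

variable (sI : Equiv.Perm I) (sJ : Equiv.Perm J) (H V : I → J → Bool)

/-- `H i j` opens the passage from the cell `(i, j)` to its right neighbour and `V i j` the one to
its upper neighbour. An open passage exchanges the two opposite corners of the face between the two
cells from which `torusRot` moves along that face. -/
def torusCrossFun : (I × Bool) × (J × Bool) → (I × Bool) × (J × Bool)
  | ((i, false), (j, false)) =>
    if V i (sJ.symm j) then ((i, true), (sJ.symm j, true)) else ((i, false), (j, false))
  | ((i, true), (j, false)) =>
    if H i j then ((sI i, false), (j, true)) else ((i, true), (j, false))
  | ((i, true), (j, true)) =>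
    if V i j then ((i, false), (sJ j, false)) else ((i, true), (j, true))
  | ((i, false), (j, true)) =>
    if H (sI.symm i) j then ((sI.symm i, true), (j, false)) else ((i, false), (j, true))

theorem torusCrossFun_involutive : Function.Involutive (torusCrossFun sI sJ H V) := by
  rintro ⟨⟨i, _ | _⟩, ⟨j, _ | _⟩⟩ <;> simp only [torusCrossFun] <;> split_ifs <;>
    simp_all

/-- The involution `torusCrossFun` as a permutation. -/
def torusCross : Equiv.Perm ((I × Bool) × (J × Bool)) :=
  (torusCrossFun_involutive sI sJ H V).toPerm

/-- The tour of the squares merged through the open passages. -/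
def tour : Equiv.Perm ((I × Bool) × (J × Bool)) := torusRot * torusCross sI sJ H V

theorem tour_apply (v) : tour sI sJ H V v = torusRot (torusCrossFun sI sJ H V v) := rfl

theorem tour_symm_apply (v) :
    (tour sI sJ H V).symm v = torusCrossFun sI sJ H V (torusRot.symm v) := rfl

/-- The diagonal translation of the torus. -/
def diagShift : Equiv.Perm ((I × Bool) × (J × Bool)) :=
  Equiv.prodCongr (double sI) (double sJ)

theorem diagShift_apply (v) : diagShift sI sJ v = (double sI v.1, double sJ v.2) := rfl

theorem diagShift_symm_apply (v) :
    (diagShift sI sJ).symm v = ((double sI).symm v.1, (double sJ).symm v.2) := rfl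

/-- The squares of the other colour class, shifted by `diagShift` to the position of the cells,
are merged across the same faces, each of which is now crossed in the other direction. -/
def dualTour : Equiv.Perm ((I × Bool) × (J × Bool)) :=
  diagShift sI sJ * tour sI sJ (fun i j => V (sI i) j) (fun i j => H i (sJ j)) *
    (diagShift sI sJ)⁻¹

theorem dualTour_apply (v) : dualTour sI sJ H V v = diagShift sI sJ
    (tour sI sJ (fun i j => V (sI i) j) (fun i j => H i (sJ j)) ((diagShift sI sJ).symm v)) := rfl

theorem dualTour_symm_apply (v) : (dualTour sI sJ H V).symm v = diagShift sI sJ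
    ((tour sI sJ (fun i j => V (sI i) j) (fun i j => H i (sJ j))).symm
      ((diagShift sI sJ).symm v)) := rfl

variable {sI sJ}

/-- The two tours together use the edges to all four neighbours of a vertex. -/
theorem tour_step_or_dualTour_step (v w : (I × Bool) × (J × Bool)) :
    (tour sI sJ H V).Step v w ∨ (dualTour sI sJ H V).Step v w ↔
      (double sI).Step v.1 w.1 ∧ v.2 = w.2 ∨ (double sJ).Step v.2 w.2 ∧ v.1 = w.1 := by
  have key : (w = tour sI sJ H V v ∨ w = (tour sI sJ H V).symm v) ∨
      (w = dualTour sI sJ H V v ∨ w = (dualTour sI sJ H V).symm v) ↔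
      w = (double sI v.1, v.2) ∨ w = ((double sI).symm v.1, v.2) ∨
        w = (v.1, double sJ v.2) ∨ w = (v.1, (double sJ).symm v.2) := by
    obtain ⟨⟨i, _ | _⟩, ⟨j, _ | _⟩⟩ := v <;>
    simp only [tour_apply, tour_symm_apply, dualTour_apply, dualTour_symm_apply, diagShift_apply,
      diagShift_symm_apply, torusRot, torusCrossFun, double_false, double_true, double_symm_false,
      double_symm_true, Equiv.coe_fn_mk, Equiv.coe_fn_symm_mk, Bool.not_true, Bool.not_false,
      Equiv.apply_symm_apply] <;> split_ifs <;> simp <;>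
      exact iff_of_eq (by ac_rfl)
  simp only [Equiv.Perm.step_iff]
  rw [key]
  obtain ⟨x, y⟩ := w
  simp only [Prod.mk.injEq, @eq_comm _ v.1, @eq_comm _ v.2, or_and_right, and_or_left, or_assoc,
    and_comm (b := x = v.1)]

/-- The two tours have no edge in common. A permutation `sI` or `sJ` with a fixed point would
turn two neighbours of a vertex into one. -/
theorem tour_step_disjoint (hI : ∀ i, sI i ≠ i) (hJ : ∀ j, sJ j ≠ j)
    (v w : (I × Bool) × (J × Bool)) (h : (tour sI sJ H V).Step v w) :
    ¬ (dualTour sI sJ H V).Step v w := by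
  have hI' : ∀ i, sI.symm i ≠ i := fun i h => hI i ((Equiv.symm_apply_eq _).1 h).symm
  have hJ' : ∀ j, sJ.symm j ≠ j := fun j h => hJ j ((Equiv.symm_apply_eq _).1 h).symm
  rw [Equiv.Perm.step_iff] at h ⊢
  revert h
  obtain ⟨⟨i, _ | _⟩, ⟨j, _ | _⟩⟩ := v <;>
  simp only [tour_apply, tour_symm_apply, dualTour_apply, dualTour_symm_apply, diagShift_apply,
    diagShift_symm_apply, torusRot, torusCrossFun, double_symm_false,
    double_symm_true, Equiv.coe_fn_mk, Equiv.coe_fn_symm_mk, Bool.not_true, Bool.not_false,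
    Equiv.apply_symm_apply] <;> split_ifs <;> rintro (rfl | rfl) (h | h) <;>
    simp [hI, hJ, hI', hJ', (hI _).symm, (hJ _).symm, (hI' _).symm, (hJ' _).symm] at h

theorem torusRot_connects (w w' : (I × Bool) × (J × Bool)) (h : torusCell w = torusCell w') :
    ∃ n : ℕ, (torusRot ^ n) w = w' := by
  obtain ⟨⟨i, a⟩, ⟨j, b⟩⟩ := w
  obtain ⟨⟨i', a'⟩, ⟨j', b'⟩⟩ := w'
  obtain ⟨rfl, rfl⟩ := Prod.ext_iff.1 h
  obtain _ | _ := a <;> obtain _ | _ := b <;> obtain _ | _ := a' <;> obtain _ | _ := b' <;>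
    first
    | exact ⟨0, rfl⟩
    | exact ⟨1, rfl⟩
    | exact ⟨2, rfl⟩
    | exact ⟨3, rfl⟩

theorem card_torusCell (t : I × J) :
    Nat.card {w : (I × Bool) × (J × Bool) // torusCell w = t} = 4 := by
  have e : {w : (I × Bool) × (J × Bool) // torusCell w = t} ≃ Bool × Bool :=
    { toFun := fun w => (w.1.1.2, w.1.2.2)
      invFun := fun b => ⟨((t.1, b.1), (t.2, b.2)), rfl⟩
      left_inv := by
        rintro ⟨w, rfl⟩
        rfl
      right_inv := fun _ => rfl }
  rw [Nat.card_congr e]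
  simp

end Torus

/-! ### Patterns of links -/

/-- A cell is linked to its right neighbour, to its upper neighbour, or to neither. -/
inductive Link
  | right
  | up
  | none

/-- Whether a link goes to the right. -/
def Link.isRight : Link → Bool
  | right => true
  | _ => false

/-- Whether a link goes up. -/
def Link.isUp : Link → Bool
  | up => true
  | _ => false

theorem Link.eq_right_of_isRight : ∀ {l : Link}, l.isRight = true → l = .right
  | right, _ => rfl

theorem Link.eq_up_of_isUp : ∀ {l : Link}, l.isUp = true → l = .up
  | up, _ => rfl

section Pattern

variable {I J : Type*} (sI : Equiv.Perm I) (sJ : Equiv.Perm J) (a : I → J → Link)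

/-- The cell that the link of a given cell leads to. -/
def upParent (t : I × J) : Option (I × J) :=
  match a t.1 t.2 with
  | .right => some (sI t.1, t.2)
  | .up => some (t.1, sJ t.2)
  | .none => none

/-- The face crossed by a link is also a face between two squares of the other colour class; it
is crossed downwards by a link to the right, and leftwards by a link upwards. -/
def downParent (t : I × J) : Option (I × J) :=
  match a t.1 t.2 with
  | .right => some (t.1, sJ.symm t.2)
  | .up => some (sI.symm t.1, t.2)
  | .none => none

variable {sI sJ a}

theorem upParent_eq_none {t : I × J} : upParent sI sJ a t = none ↔ a t.1 t.2 = .none := by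
  unfold upParent
  split <;> simp_all

theorem downParent_eq_none {t : I × J} : downParent sI sJ a t = none ↔ a t.1 t.2 = .none := by
  unfold downParent
  split <;> simp_all

theorem card_orbit_tour_of_upParent [Finite I] [Finite J] {k : ℕ}
    (h : IsForestOfSize (upParent sI sJ a) k) (v : (I × Bool) × (J × Bool)) :
    Nat.card {w // (tour sI sJ (fun i j => (a i j).isRight)
      (fun i j => (a i j).isUp)).SameCycle v w} = 4 * k := by
  refine card_orbit_tour (cross := torusCross ..) (cell := torusCell)
    (out := fun t => match a t.1 t.2 with
    | .right => some ((t.1, true), (t.2, false))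
    | .up => some ((t.1, true), (t.2, true))
    | .none => none) h (torusCrossFun_involutive _ _ _ _) torusRot_connects (fun _ => rfl) ?_ ?_ ?_
    card_torusCell v
  · rintro ⟨i, j⟩ w hw
    rcases ha : a i j with _ | _ | _ <;> simp only [ha] at hw
    · obtain rfl := Option.some.inj hw
      simp [upParent, ha, torusCell, torusCross, torusCrossFun, Link.isRight]
    · obtain rfl := Option.some.inj hw
      simp [upParent, ha, torusCell, torusCross, torusCrossFun, Link.isUp]
    · simp at hw
  · rintro ⟨i, j⟩ hw
    rcases ha : a i j with _ | _ | _ <;> simp_all [upParent]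
  · rintro ⟨⟨i, _ | _⟩, ⟨j, _ | _⟩⟩ hw <;>
    simp only [torusCross, Function.Involutive.coe_toPerm, torusCrossFun] at hw ⊢ <;>
    split_ifs at hw ⊢ with hl <;>
    first
    | exact absurd rfl hw
    | simp [torusCell, Link.eq_right_of_isRight hl]
    | simp [torusCell, Link.eq_up_of_isUp hl]

theorem card_orbit_dualTour_of_downParent [Finite I] [Finite J] {k : ℕ}
    (h : IsForestOfSize (downParent sI sJ a) k) (v : (I × Bool) × (J × Bool)) :
    Nat.card {w // (dualTour sI sJ (fun i j => (a i j).isRight)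
      (fun i j => (a i j).isUp)).SameCycle v w} = 4 * k := by
  have hconj : ∀ w, (dualTour sI sJ (fun i j => (a i j).isRight)
      (fun i j => (a i j).isUp)).SameCycle v w ↔
      (tour sI sJ (fun i j => (a (sI i) j).isUp) (fun i j => (a i (sJ j)).isRight)).SameCycle
        ((diagShift sI sJ).symm v) ((diagShift sI sJ).symm w) :=
    fun w => Equiv.Perm.sameCycle_conj
  rw [Nat.card_congr ((diagShift sI sJ).symm.subtypeEquiv hconj)]
  refine card_orbit_tour (cross := torusCross ..) (cell := torusCell)
    (out := fun t => match a t.1 t.2 with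
    | .right => some ((t.1, false), (t.2, false))
    | .up => some ((t.1, false), (t.2, true))
    | .none => none) h (torusCrossFun_involutive _ _ _ _) torusRot_connects (fun _ => rfl) ?_ ?_ ?_
    card_torusCell _
  · rintro ⟨i, j⟩ w hw
    rcases ha : a i j with _ | _ | _ <;> simp only [ha] at hw
    · obtain rfl := Option.some.inj hw
      simp [downParent, ha, torusCell, torusCross, torusCrossFun, Link.isRight]
    · obtain rfl := Option.some.inj hw
      simp [downParent, ha, torusCell, torusCross, torusCrossFun, Link.isUp]
    · simp at hw
  · rintro ⟨i, j⟩ hw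
    rcases ha : a i j with _ | _ | _ <;> simp_all [downParent]
  · rintro ⟨⟨i, _ | _⟩, ⟨j, _ | _⟩⟩ hw <;>
    simp only [torusCross, Function.Involutive.coe_toPerm, torusCrossFun,
      Equiv.apply_symm_apply] at hw ⊢ <;>
    split_ifs at hw ⊢ with hl <;>
    first
    | exact absurd rfl hw
    | simp [torusCell, Link.eq_right_of_isRight hl]
    | simp [torusCell, Link.eq_up_of_isUp hl]

/-- A fixed-point-free cyclic permutation of `2 * m` elements, doubled, steps through the edges
of a cycle graph. -/
theorem exists_iso_double {I : Type*} [Finite I] {s : Equiv.Perm I} {m : ℕ}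
    (hcard : Nat.card I = 2 * m) (hm : 0 < m) (hs : ∀ i i', s.SameCycle i i') :
    (∀ i, s i ≠ i) ∧ ∃ G : SimpleGraph (I × Bool), (∀ x y, G.Adj x y ↔ (double s).Step x y) ∧
      Nonempty (G ≃g SimpleGraph.cycleGraph (4 * m)) := by
  have hfix : ∀ i, s i ≠ i := by
    intro i hi
    have : Subsingleton I := ⟨fun x y => by
      rw [← (hs i x).eq_of_left hi, ← (hs i y).eq_of_left hi]⟩
    have := Finite.card_le_one_iff_subsingleton.2 this
    omega
  have hdouble : ∀ x, double s x ≠ x := by rintro ⟨i, _ | _⟩ <;> simp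
  have hpos : 0 < Nat.card I := by omega
  obtain ⟨i⟩ := (Nat.card_pos_iff.1 hpos).1
  refine ⟨hfix, ⟨(double s).Step, ⟨fun _ _ h => h.symm⟩, ⟨fun x h => ?_⟩⟩,
    fun _ _ => Iff.rfl, ?_⟩
  · exact hdouble x (by rcases h with h | h <;> exact h.symm)
  · obtain ⟨n, hn⟩ : ∃ n, 4 * m = n + 2 := ⟨4 * m - 2, by omega⟩
    rw [hn]
    refine Equiv.Perm.nonempty_iso_cycleGraph (σ := double s) ?_ (i, false)
      (double_sameCycle hs _) (fun _ _ => Iff.rfl)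
    rw [Nat.card_prod, hcard, ← hn]
    simp
    omega

/-- A pattern of links whose upward and downward parent maps are both forests of trees with `k`
nodes gives a decomposition of the torus into cycles of length `4 * k`. -/
theorem decomposes_of_links {I J : Type*} [Finite I] [Finite J] {sI : Equiv.Perm I}
    {sJ : Equiv.Perm J} {m n k : ℕ} (hk : 0 < k) (hm : 0 < m) (hn : 0 < n)
    (hI : Nat.card I = 2 * m) (hJ : Nat.card J = 2 * n) (hsI : ∀ i i', sI.SameCycle i i')
    (hsJ : ∀ j j', sJ.SameCycle j j') (a : I → J → Link)
    (hup : IsForestOfSize (upParent sI sJ a) k) (hdown : IsForestOfSize (downParent sI sJ a) k) :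
    (SimpleGraph.cycleGraph (4 * k)).Decomposes
      ((SimpleGraph.cycleGraph (4 * m)).boxProd (SimpleGraph.cycleGraph (4 * n))) := by
  obtain ⟨hfixI, GI, hGI, ⟨eI⟩⟩ := exists_iso_double hI hm hsI
  obtain ⟨hfixJ, GJ, hGJ, ⟨eJ⟩⟩ := exists_iso_double hJ hn hsJ
  have e : GI.boxProd GJ ≃g
      (SimpleGraph.cycleGraph (4 * m)).boxProd (SimpleGraph.cycleGraph (4 * n)) :=
    ⟨Equiv.prodCongr eI.toEquiv eJ.toEquiv, by
      rintro ⟨x, y⟩ ⟨x', y'⟩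
      simp only [SimpleGraph.boxProd_adj, Equiv.prodCongr_apply, Prod.map, RelIso.coe_fn_toEquiv,
        eI.map_adj_iff, eJ.map_adj_iff, eI.injective.eq_iff, eJ.injective.eq_iff]⟩
  refine SimpleGraph.Decomposes.of_iso ?_ e
  obtain ⟨l, hl⟩ : ∃ l, 4 * k = l + 2 := ⟨4 * k - 2, by omega⟩
  rw [hl]
  refine SimpleGraph.cycleGraph_decomposes_of_perm
    (σ := tour sI sJ (fun i j => (a i j).isRight) (fun i j => (a i j).isUp))
    (τ := dualTour sI sJ (fun i j => (a i j).isRight) (fun i j => (a i j).isUp)) ?_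
    (tour_step_disjoint _ _ hfixI hfixJ) ?_ ?_
  · intro x y
    rw [tour_step_or_dualTour_step, SimpleGraph.boxProd_adj, hGI, hGJ]
  · rw [← hl]
    exact card_orbit_tour_of_upParent hup
  · rw [← hl]
    exact card_orbit_dualTour_of_downParent hdown

end Pattern

/-! ### Blocks of cells -/

section Carry

variable {A : Type*} {a : ℕ} [NeZero a]

/-- Counting with digits in `Fin a` and carries to `s`: the successor of `(q, x)` is `(q, x + 1)`,
or `(s q, 0)` if `x` is the last digit. -/
def carry (a : ℕ) [NeZero a] (s : Equiv.Perm A) : Equiv.Perm (A × Fin a) where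
  toFun t := if h : t.2.val + 1 < a then (t.1, ⟨t.2.val + 1, h⟩) else (s t.1, 0)
  invFun t := if t.2.val = 0 then (s.symm t.1, ⟨a - 1, by have := NeZero.pos a; omega⟩)
    else (t.1, ⟨t.2.val - 1, by omega⟩)
  left_inv := by
    rintro ⟨q, x, hx⟩
    by_cases h : x + 1 < a
    · simp [h]
    · simp [h]
      omega
  right_inv := by
    rintro ⟨q, x, hx⟩
    by_cases h : x = 0
    · subst h
      have : ¬ a - 1 + 1 < a := by omega
      simp [this]
    · have : x - 1 + 1 < a := by omega
      simp [h, this]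
      omega

theorem carry_fst (s : Equiv.Perm A) (t : A × Fin a) :
    (carry a s t).1 = if t.2.val + 1 < a then t.1 else s t.1 := by
  simp only [carry, Equiv.coe_fn_mk]
  split_ifs <;> rfl

theorem carry_snd (s : Equiv.Perm A) (t : A × Fin a) :
    (carry a s t).2.val = if t.2.val + 1 < a then t.2.val + 1 else 0 := by
  simp only [carry, Equiv.coe_fn_mk]
  split_ifs <;> rfl

theorem carry_symm_fst (s : Equiv.Perm A) (t : A × Fin a) :
    ((carry a s).symm t).1 = if t.2.val = 0 then s.symm t.1 else t.1 := by
  simp only [carry, Equiv.coe_fn_symm_mk]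
  split_ifs <;> rfl

theorem carry_symm_snd (s : Equiv.Perm A) (t : A × Fin a) :
    ((carry a s).symm t).2.val = if t.2.val = 0 then a - 1 else t.2.val - 1 := by
  simp only [carry, Equiv.coe_fn_symm_mk]
  split_ifs <;> rfl

theorem carry_sameCycle {s : Equiv.Perm A} (hs : ∀ q q', s.SameCycle q q') (t t' : A × Fin a) :
    (carry a s).SameCycle t t' := by
  have hdigit : ∀ (x : ℕ) (hx : x < a) q, (carry a s).SameCycle (q, 0) (q, ⟨x, hx⟩) := by
    intro x hx q
    induction x with
    | zero => exact Equiv.Perm.SameCycle.refl _ _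
    | succ x ih =>
      refine (ih (by omega)).trans ?_
      have : carry a s (q, ⟨x, by omega⟩) = (q, ⟨x + 1, hx⟩) := by simp [carry, hx]
      rw [← this]
      exact Equiv.Perm.sameCycle_apply_right.2 (Equiv.Perm.SameCycle.refl _ _)
  have hstep : ∀ q, (carry a s).SameCycle (q, 0) (s q, 0) := by
    intro q
    have hlt : a - 1 < a := by have := NeZero.pos a; omega
    refine (hdigit (a - 1) hlt q).trans ?_
    have : carry a s (q, ⟨a - 1, hlt⟩) = (s q, 0) := by
      have : ¬ a - 1 + 1 < a := by omega
      simp [carry, this]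
    rw [← this]
    exact Equiv.Perm.sameCycle_apply_right.2 (Equiv.Perm.SameCycle.refl _ _)
  have hpow : ∀ (n : ℕ) q, (carry a s).SameCycle (q, 0) ((s ^ n) q, 0) := by
    intro n q
    induction n with
    | zero => exact Equiv.Perm.SameCycle.refl _ _
    | succ n ih =>
      rw [pow_succ', Equiv.Perm.mul_apply]
      exact ih.trans (hstep _)
  have hzero : ∀ q q', (carry a s).SameCycle (q, 0) (q', 0) := by
    intro q q'
    obtain ⟨n, hn⟩ := hs q q'
    obtain ⟨n, rfl | rfl⟩ := n.eq_nat_or_neg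
    · rw [zpow_natCast] at hn
      exact hn ▸ hpow n q
    · rw [zpow_neg, Equiv.Perm.inv_eq_iff_eq, zpow_natCast] at hn
      exact (hn ▸ hpow n q').symm
  obtain ⟨q, x, hx⟩ := t
  obtain ⟨q', x', hx'⟩ := t'
  exact ((hdigit x hx q).symm.trans (hzero q q')).trans (hdigit x' hx' q')

end Carry

section Blocks

variable {A B : Type} [Finite A] [Finite B] (sA : Equiv.Perm A) (sB : Equiv.Perm B)

/-- Links inside a block of `a` columns and `b` rows of cells: the upper right cell has no link,
the other cells of the last column and the last row have links upwards. -/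
def blockLink (a b x y : ℕ) : Link :=
  if x + 1 = a ∧ y + 1 = b then .none else if x + 1 = a ∨ y + 1 = b then .up else .right

theorem blockLink_eq_none {a b x y : ℕ} :
    blockLink a b x y = .none ↔ x + 1 = a ∧ y + 1 = b := by
  unfold blockLink
  split_ifs <;> simp_all

/-- Trees of links in upward orientation: the cells of the last row, the upper right one excepted, are
in the tree of the block above them, and all other cells are in the tree of their own block. -/
theorem blockLink_up_forest {a b : ℕ} [NeZero a] [NeZero b] (hab : a = 1 ↔ b = 1) :
    IsForestOfSize (upParent (carry a sA) (carry b sB)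
      (fun i j => blockLink a b i.2 j.2)) (a * b) := by
  have key := IsForestOfSize.of_injective (R := A × B) (K := Fin a × Fin b)
    (p := upParent (carry a sA) (carry b sB) (fun i j => blockLink a b i.2 j.2))
    (root := fun t => (t.1.1, if t.2.2.val + 1 = b ∧ t.1.2.val + 1 ≠ a then sB t.2.1 else t.2.1))
    (loc := fun t => (t.1.2, t.2.2))
    (rank := fun t => if t.1.2.val + 1 = a then a + t.2.2 else
      if t.2.2.val + 1 = b then 0 else 1 + t.1.2)
    ?_ ?_ ?_ ?_
  · simpa using key
  · rintro ⟨⟨q, x, hx⟩, ⟨r, y, hy⟩⟩ t' h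
    simp only [upParent, blockLink] at h
    split_ifs at h <;> simp only [Option.some.injEq] at h <;> subst h <;>
      simp only [carry_fst, carry_snd, Prod.mk.injEq] <;> grind
  · rintro ⟨⟨q, x, hx⟩, ⟨r, y, hy⟩⟩ ⟨⟨q', x', hx'⟩, ⟨r', y', hy'⟩⟩ h h' hroot
    rw [upParent_eq_none, blockLink_eq_none] at h h'
    simp only [Prod.mk.injEq, Fin.mk.injEq] at h h' hroot ⊢
    grind
  · rintro ⟨⟨q, x, hx⟩, ⟨r, y, hy⟩⟩ ⟨⟨q', x', hx'⟩, ⟨r', y', hy'⟩⟩ hroot hloc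
    simp only [Prod.mk.injEq, Fin.mk.injEq] at hroot hloc ⊢
    grind [Equiv.apply_eq_iff_eq]
  · simp only [Nat.card_prod, Nat.card_fin]
    ring

/-- Trees of links in downward orientation: the rows below the last one are in the tree rooted in the
block diagonally below to the left, and the last row except its right end in the tree of the
block to the left. -/
theorem blockLink_down_forest {a b : ℕ} [NeZero a] [NeZero b] (hab : a = 1 ↔ b = 1) :
    IsForestOfSize (downParent (carry a sA) (carry b sB)
      (fun i j => blockLink a b i.2 j.2)) (a * b) := by
  have key := IsForestOfSize.of_injective (R := A × B) (K := Fin a × Fin b)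
    (p := downParent (carry a sA) (carry b sB) (fun i j => blockLink a b i.2 j.2))
    (root := fun t => (if t.1.2.val + 1 = a ∧ t.2.2.val + 1 = b then t.1.1 else sA.symm t.1.1,
      if t.2.2.val + 1 = b then t.2.1 else sB.symm t.2.1))
    (loc := fun t => (t.1.2, t.2.2))
    (rank := fun t => if t.2.2.val + 1 = b then
      (if t.1.2.val + 1 = a then a + b + 1 else b + (a - t.1.2))
      else if t.1.2.val + 1 = a then 0 else b - t.2.2)
    ?_ ?_ ?_ ?_
  · simpa using key
  · rintro ⟨⟨q, x, hx⟩, ⟨r, y, hy⟩⟩ t' h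
    simp only [downParent, blockLink] at h
    split_ifs at h <;> simp only [Option.some.injEq] at h <;> subst h <;>
      simp only [carry_symm_fst, carry_symm_snd, Prod.mk.injEq] <;> grind
  · rintro ⟨⟨q, x, hx⟩, ⟨r, y, hy⟩⟩ ⟨⟨q', x', hx'⟩, ⟨r', y', hy'⟩⟩ h h' hroot
    rw [downParent_eq_none, blockLink_eq_none] at h h'
    simp only [Prod.mk.injEq, Fin.mk.injEq] at h h' hroot ⊢
    grind
  · rintro ⟨⟨q, x, hx⟩, ⟨r, y, hy⟩⟩ ⟨⟨q', x', hx'⟩, ⟨r', y', hy'⟩⟩ hroot hloc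
    simp only [Prod.mk.injEq, Fin.mk.injEq] at hroot hloc ⊢
    grind [Equiv.apply_eq_iff_eq]
  · simp only [Nat.card_prod, Nat.card_fin]
    ring

/-- Links in blocks of two by two cells that form trees with two nodes. -/
def pairLink (x y : ℕ) : Link :=
  if x = y then .right else .none

theorem pairLink_eq_none {x y : ℕ} : pairLink x y = .none ↔ x ≠ y := by
  unfold pairLink
  split_ifs <;> simp_all

theorem pairLink_up_forest :
    IsForestOfSize (upParent (carry 2 sA) (carry 2 sB)
      (fun i j => pairLink i.2 j.2)) 2 := by
  have key := IsForestOfSize.of_injective (R := A × B × Bool) (K := Fin 2)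
    (p := upParent (carry 2 sA) (carry 2 sB) (fun i j => pairLink i.2 j.2))
    (root := fun t => (if t.1.2.val = 1 ∧ t.2.2.val = 1 then sA t.1.1 else t.1.1, t.2.1,
      decide (t.2.2.val = 0)))
    (loc := fun t => t.1.2)
    (rank := fun t => if t.1.2.val = t.2.2.val then 0 else 1)
    ?_ ?_ ?_ ?_
  · simpa using key
  · rintro ⟨⟨q, x, hx⟩, ⟨r, y, hy⟩⟩ t' h
    simp only [upParent, pairLink] at h
    split_ifs at h
    simp only [Option.some.injEq] at h
    subst h
    simp only [carry_fst, carry_snd, Prod.mk.injEq]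
    grind
  · rintro ⟨⟨q, x, hx⟩, ⟨r, y, hy⟩⟩ ⟨⟨q', x', hx'⟩, ⟨r', y', hy'⟩⟩ h h' hroot
    rw [upParent_eq_none, pairLink_eq_none] at h h'
    simp only [Prod.mk.injEq, Fin.mk.injEq, decide_eq_decide] at h h' hroot ⊢
    grind
  · rintro ⟨⟨q, x, hx⟩, ⟨r, y, hy⟩⟩ ⟨⟨q', x', hx'⟩, ⟨r', y', hy'⟩⟩ hroot hloc
    simp only [Prod.mk.injEq, Fin.mk.injEq, decide_eq_decide] at hroot hloc ⊢
    grind [Equiv.apply_eq_iff_eq]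
  · simp only [Nat.card_prod, Nat.card_fin, Nat.card_eq_fintype_card (α := Bool), Fintype.card_bool]
    ring

theorem pairLink_down_forest :
    IsForestOfSize (downParent (carry 2 sA) (carry 2 sB)
      (fun i j => pairLink i.2 j.2)) 2 := by
  have key := IsForestOfSize.of_injective (R := A × B × Bool) (K := Fin 2)
    (p := downParent (carry 2 sA) (carry 2 sB) (fun i j => pairLink i.2 j.2))
    (root := fun t => (t.1.1, if t.1.2.val = 0 ∧ t.2.2.val = 0 then sB.symm t.2.1 else t.2.1,
      decide (t.1.2.val = 0)))
    (loc := fun t => t.2.2)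
    (rank := fun t => if t.1.2.val = t.2.2.val then 0 else 1)
    ?_ ?_ ?_ ?_
  · simpa using key
  · rintro ⟨⟨q, x, hx⟩, ⟨r, y, hy⟩⟩ t' h
    simp only [downParent, pairLink] at h
    split_ifs at h
    simp only [Option.some.injEq] at h
    subst h
    simp only [carry_symm_fst, carry_symm_snd, Prod.mk.injEq]
    grind
  · rintro ⟨⟨q, x, hx⟩, ⟨r, y, hy⟩⟩ ⟨⟨q', x', hx'⟩, ⟨r', y', hy'⟩⟩ h h' hroot
    rw [downParent_eq_none, pairLink_eq_none] at h h'
    simp only [Prod.mk.injEq, Fin.mk.injEq, decide_eq_decide] at h h' hroot ⊢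
    grind
  · rintro ⟨⟨q, x, hx⟩, ⟨r, y, hy⟩⟩ ⟨⟨q', x', hx'⟩, ⟨r', y', hy'⟩⟩ hroot hloc
    simp only [Prod.mk.injEq, Fin.mk.injEq, decide_eq_decide] at hroot hloc ⊢
    grind [Equiv.apply_eq_iff_eq]
  · simp only [Nat.card_prod, Nat.card_fin, Nat.card_eq_fintype_card (α := Bool), Fintype.card_bool]
    ring

/-- Links in blocks of two columns and `2 * h + 1` rows of cells that form two trees with
`2 * h + 1` nodes, with roots `(1, 0)` and `(0, h + 1)`. -/
def oddLink (h x y : ℕ) : Link :=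
  if x = 1 ∧ y = 0 ∨ x = 0 ∧ y = h + 1 then .none
  else if x = 0 ∧ 1 ≤ y ∧ y ≤ h ∨ x = 1 ∧ h + 1 ≤ y then .up else .right

theorem oddLink_eq_none {h x y : ℕ} :
    oddLink h x y = .none ↔ x = 1 ∧ y = 0 ∨ x = 0 ∧ y = h + 1 := by
  unfold oddLink
  split_ifs <;> simp_all

/-- Trees of links in upward orientation: the rows from `1` to `h` run into the cell `(0, h + 1)`,
those of the second column crossing to the next block, and all else runs into the cell `(1, 0)`. -/
theorem oddLink_up_forest {h : ℕ} (hh : 0 < h) :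
    IsForestOfSize (upParent (carry 2 sA) (carry (2 * h + 1) sB)
      (fun i j => oddLink h i.2 j.2)) (2 * h + 1) := by
  have key := IsForestOfSize.of_injective (R := A × B × Bool) (K := Fin (2 * h + 1))
    (p := upParent (carry 2 sA) (carry (2 * h + 1) sB) (fun i j => oddLink h i.2 j.2))
    (root := fun t => (if t.1.2.val = 1 ∧ 1 ≤ t.2.2.val ∧ t.2.2.val ≤ h then sA t.1.1 else t.1.1,
      if h + 1 < t.2.2.val ∨ t.1.2.val = 1 ∧ t.2.2.val = h + 1 then sB t.2.1 else t.2.1,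
      decide (1 ≤ t.2.2.val ∧ t.2.2.val ≤ h ∨ t.1.2.val = 0 ∧ t.2.2.val = h + 1)))
    (loc := fun t => ⟨if 1 ≤ t.2.2.val ∧ t.2.2.val ≤ h + 1 then
        (if t.1.2.val = 0 then t.2.2 - 1 else if t.2.2.val = h + 1 then 2 else h + t.2.2)
      else if t.2.2.val = 0 then t.1.2
      else if t.1.2.val = 0 then t.2.2 else t.2.2 - h + 1, by
        obtain ⟨⟨q, x, hx⟩, ⟨r, y, hy⟩⟩ := t
        dsimp only
        split_ifs <;> omega⟩)
    (rank := fun t => if t.2.2.val = 0 then (if t.1.2.val = 0 then 0 else 2 * h + 2)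
      else if t.2.2.val ≤ h + 1 ∧ t.1.2.val = 0 ∨ h + 1 ≤ t.2.2.val ∧ t.1.2.val = 1 then t.2.2
      else 0)
    ?_ ?_ ?_ ?_
  · simpa using key
  · rintro ⟨⟨q, x, hx⟩, ⟨r, y, hy⟩⟩ t' h
    simp only [upParent, oddLink] at h
    split_ifs at h <;> simp only [Option.some.injEq] at h <;> subst h <;>
      simp only [carry_fst, carry_snd, Prod.mk.injEq, decide_eq_decide] <;> grind
  · rintro ⟨⟨q, x, hx⟩, ⟨r, y, hy⟩⟩ ⟨⟨q', x', hx'⟩, ⟨r', y', hy'⟩⟩ h h' hroot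
    rw [upParent_eq_none, oddLink_eq_none] at h h'
    simp only [Prod.mk.injEq, Fin.mk.injEq, decide_eq_decide] at h h' hroot ⊢
    grind
  · rintro ⟨⟨q, x, hx⟩, ⟨r, y, hy⟩⟩ ⟨⟨q', x', hx'⟩, ⟨r', y', hy'⟩⟩ hroot hloc
    simp only [Prod.mk.injEq, Fin.mk.injEq, decide_eq_decide] at hroot hloc ⊢
    split_ifs at hloc <;> grind [Equiv.apply_eq_iff_eq]
  · simp only [Nat.card_prod, Nat.card_fin, Nat.card_eq_fintype_card (α := Bool), Fintype.card_bool]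
    ring

/-- Trees of links in downward orientation: the rows from `h + 1` onwards and the cell `(0, 0)` run
into the cell `(0, h + 1)`, and the rest runs into the cell `(1, 0)`. -/
theorem oddLink_down_forest {h : ℕ} (hh : 0 < h) :
    IsForestOfSize (downParent (carry 2 sA) (carry (2 * h + 1) sB)
      (fun i j => oddLink h i.2 j.2)) (2 * h + 1) := by
  have key := IsForestOfSize.of_injective (R := A × B × Bool) (K := Fin (2 * h + 1))
    (p := downParent (carry 2 sA) (carry (2 * h + 1) sB) (fun i j => oddLink h i.2 j.2))
    (root := fun t => (if t.1.2.val = 0 ∧ 1 ≤ t.2.2.val ∧ t.2.2.val ≤ h then sA.symm t.1.1 else t.1.1,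
      if t.1.2.val = 0 ∧ t.2.2.val = 0 then sB.symm t.2.1 else t.2.1,
      decide (h + 1 ≤ t.2.2.val ∨ t.1.2.val = 0 ∧ t.2.2.val = 0)))
    (loc := fun t => ⟨if t.1.2.val = 1 then t.2.2 else if t.2.2.val = 0 then 0
      else if t.2.2.val ≤ h then h + t.2.2 else t.2.2 - h, by
        obtain ⟨⟨q, x, hx⟩, ⟨r, y, hy⟩⟩ := t
        dsimp only
        split_ifs <;> omega⟩)
    (rank := fun t => if t.1.2.val = 0 ∧ t.2.2.val = 0 then 1
      else if t.2.2.val ≤ h ∧ t.1.2.val = 1 ∨ h + 1 ≤ t.2.2.val ∧ t.1.2.val = 0 then 2 * h + 3 - t.2.2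
      else 0)
    ?_ ?_ ?_ ?_
  · simpa using key
  · rintro ⟨⟨q, x, hx⟩, ⟨r, y, hy⟩⟩ t' h
    simp only [downParent, oddLink] at h
    split_ifs at h <;> simp only [Option.some.injEq] at h <;> subst h <;>
      simp only [carry_symm_fst, carry_symm_snd, Prod.mk.injEq, decide_eq_decide] <;> grind
  · rintro ⟨⟨q, x, hx⟩, ⟨r, y, hy⟩⟩ ⟨⟨q', x', hx'⟩, ⟨r', y', hy'⟩⟩ h h' hroot
    rw [downParent_eq_none, oddLink_eq_none] at h h'
    simp only [Prod.mk.injEq, Fin.mk.injEq, decide_eq_decide] at h h' hroot ⊢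
    grind
  · rintro ⟨⟨q, x, hx⟩, ⟨r, y, hy⟩⟩ ⟨⟨q', x', hx'⟩, ⟨r', y', hy'⟩⟩ hroot hloc
    simp only [Prod.mk.injEq, Fin.mk.injEq, decide_eq_decide] at hroot hloc ⊢
    grind [Equiv.apply_eq_iff_eq]
  · simp only [Nat.card_prod, Nat.card_fin, Nat.card_eq_fintype_card (α := Bool), Fintype.card_bool]
    ring

end Blocks

/-! ### The decomposition -/

/-- A pattern of links depending on the column modulo `a` and the row modulo `b` gives a
decomposition if it has forests of trees of size `k`, whatever the number of blocks. -/
theorem decomposes_of_digit_links {a b m n k : ℕ} [NeZero a] [NeZero b] (hk : 0 < k) (hm : 0 < m)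
    (hn : 0 < n) (ha : a ∣ 2 * m) (hb : b ∣ 2 * n) (link : ℕ → ℕ → Link)
    (hup : ∀ {A B : Type} [Finite A] [Finite B] (sA : Equiv.Perm A) (sB : Equiv.Perm B),
      IsForestOfSize (upParent (carry a sA) (carry b sB) (fun i j => link i.2 j.2)) k)
    (hdown : ∀ {A B : Type} [Finite A] [Finite B] (sA : Equiv.Perm A) (sB : Equiv.Perm B),
      IsForestOfSize (downParent (carry a sA) (carry b sB) (fun i j => link i.2 j.2)) k) :
    (SimpleGraph.cycleGraph (4 * k)).Decomposes
      ((SimpleGraph.cycleGraph (4 * m)).boxProd (SimpleGraph.cycleGraph (4 * n))) := by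
  obtain ⟨Q, hQ⟩ := ha
  obtain ⟨Q', hQ'⟩ := hb
  have : NeZero Q := ⟨by rintro rfl; omega⟩
  have : NeZero Q' := ⟨by rintro rfl; omega⟩
  have hcyc : ∀ N (q q' : ZMod N), (Equiv.addRight (1 : ZMod N)).SameCycle q q' := by
    intro N q q'
    obtain ⟨z, hz⟩ := ZMod.intCast_surjective (q' - q)
    exact ⟨z, by simp [hz]⟩
  refine decomposes_of_links (I := ZMod Q × Fin a) (J := ZMod Q' × Fin b) hk hm hn ?_ ?_
    (carry_sameCycle (hcyc Q)) (carry_sameCycle (hcyc Q')) (fun i j => link i.2 j.2)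
    (hup _ _) (hdown _ _)
  · rw [Nat.card_prod, Nat.card_zmod, Nat.card_fin, hQ, mul_comm]
  · rw [Nat.card_prod, Nat.card_zmod, Nat.card_fin, hQ', mul_comm]

theorem decomposes_of_blocks {a b m n : ℕ} (hm : 0 < m) (hn : 0 < n) (ha : a ∣ 2 * m)
    (hb : b ∣ 2 * n) (hab : a = 1 ↔ b = 1) :
    (SimpleGraph.cycleGraph (4 * (a * b))).Decomposes
      ((SimpleGraph.cycleGraph (4 * m)).boxProd (SimpleGraph.cycleGraph (4 * n))) := by
  have ha0 : 0 < a := Nat.pos_of_dvd_of_pos ha (by omega)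
  have hb0 : 0 < b := Nat.pos_of_dvd_of_pos hb (by omega)
  have : NeZero a := ⟨ha0.ne'⟩
  have : NeZero b := ⟨hb0.ne'⟩
  exact decomposes_of_digit_links (Nat.mul_pos ha0 hb0) hm hn ha hb (blockLink a b)
    (fun sA sB => blockLink_up_forest sA sB hab) (fun sA sB => blockLink_down_forest sA sB hab)

/-- The case in which `k` divides the length of one side of the torus of squares. -/
theorem decomposes_of_dvd_right {k m n : ℕ} (hm : 0 < m) (hn : 0 < n) (hk : k ∣ 2 * n) :
    (SimpleGraph.cycleGraph (4 * k)).Decomposes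
      ((SimpleGraph.cycleGraph (4 * m)).boxProd (SimpleGraph.cycleGraph (4 * n))) := by
  have hk0 : 0 < k := Nat.pos_of_dvd_of_pos hk (by omega)
  obtain ⟨h, rfl | rfl⟩ := k.even_or_odd'
  · by_cases h1 : h = 1
    · subst h1
      exact decomposes_of_digit_links (a := 2) (b := 2) hk0 hm hn (Dvd.intro _ rfl)
        (Dvd.intro _ rfl) pairLink (fun sA sB => pairLink_up_forest sA sB)
        (fun sA sB => pairLink_down_forest sA sB)
    · exact decomposes_of_blocks hm hn (Dvd.intro _ rfl) ((Dvd.intro_left 2 rfl).trans hk)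
        (by omega)
  · rcases h.eq_zero_or_pos with rfl | hh
    · exact decomposes_of_blocks (a := 1) (b := 1) hm hn (one_dvd _) (one_dvd _) Iff.rfl
    · exact decomposes_of_digit_links (a := 2) (b := 2 * h + 1) hk0 hm hn (Dvd.intro _ rfl) hk
        (oddLink h) (fun sA sB => oddLink_up_forest sA sB hh)
        (fun sA sB => oddLink_down_forest sA sB hh)

theorem theorem2 (k m n : ℕ) (hk : 0 < k) (hm : 0 < m) (hn : 0 < n) (hdvd : k ∣ 4 * m * n) :
    (SimpleGraph.cycleGraph (4 * k)).Decomposes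
      ((SimpleGraph.cycleGraph (4 * m)).boxProd (SimpleGraph.cycleGraph (4 * n))) := by
  have hdvd' : k ∣ (2 * m) * (2 * n) := by
    have : (2 * m) * (2 * n) = 4 * m * n := by ring
    rwa [this]
  obtain ⟨a, b, ha, hb, rfl⟩ := (Nat.dvd_mul).1 hdvd'
  by_cases ha1 : a = 1
  · subst ha1
    rw [one_mul]
    exact decomposes_of_dvd_right hm hn hb
  · by_cases hb1 : b = 1
    · subst hb1
      rw [mul_one]
      exact (decomposes_of_dvd_right hn hm ha).of_iso (SimpleGraph.boxProdComm _ _)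
    · exact decomposes_of_blocks hm hn ha hb (by simp [ha1, hb1])
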